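/- Let $S^1=\mathbb R/\mathbb Z$, and let $R_\alpha(x)=x+\alpha$ be the rotation of $S^1$ by $\alpha$. For a continuous function $T:S^1\to(0,\infty)$, let $F(x,t)=(R_\alpha(x),\,t-T(x))$ on $S^1\times\mathbb R$, and let $X=\langle F\rangle\backslash(S^1\times\mathbb R)$ be the quotient by the infinite cyclic group generated by $F$. The suspension flow $\{\phi^t\}_{t\in\mathbb R}=\mathrm{sus}(R_\alpha,T)$ is the flow on $X$ induced by the translations $(x,s)\mapsto(x,s+t)$. **Theorem.** Let $a\ge 10^{10}$ be an integer, and let $\alpha$ be the irrational number with continued fraction expansion $\alpha=[0;a,a,a,\dots]$. There is a continuous function $T:S^1\to(0,\infty)$ such that $\mathrm{sus}(R_\alpha,T)$ is kinematic expansive. That is, $X$ is compact and metrizable, and for every metric $d$ inducing the topology of $X$ the following holds: for every $\epsilon>0$ there is $\delta>0$ such that, for all $x,y\in X$, if $d(\phi^t(x),\phi^t(y))<\delta$ for all $t\in\mathbb R$, then $y=\phi^s(x)$ for some $s\in(-\epsilon,\epsilon)$. Moreover, $T$ can be chosen so that the following forward-time version also holds: for every such metric $d$ and every $\epsilon>0$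 there is $\delta>0$ such that, for all $x,y\in X$, if $d(\phi^t(x),\phi^t(y))<\delta$ for all $t>0$, then $y=\phi^s(x)$ for some $s\in(-\epsilon,\epsilon)$. In particular, there exist an irrational number $\alpha$ and a positive continuous function $T$ on $S^1$ such that $\mathrm{sus}(R_\alpha,T)$ is kinematic expansive. -/

import Mathlib

open Set Filter Topology

noncomputable section

/-- A flow `φ = (φ t)_{t ∈ ℝ}` on a space `X` is *kinematic expansive* if, for every metric inducing
the topology of `X` and every `ε > 0`, there is `δ > 0` such that two points whose orbits stay
`δ`-close for all times `t ∈ ℝ` lie on the same orbit, at time distance less than `ε`.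
It is meant for compact metrizable `X`; there the choice of the metric does not matter. -/
def IsKinematicExpansive {X : Type*} [τ : TopologicalSpace X] (φ : Flow ℝ X) : Prop :=
  ∀ m : MetricSpace X, m.toPseudoMetricSpace.toUniformSpace.toTopologicalSpace = τ →
    ∀ ε : ℝ, 0 < ε → ∃ δ : ℝ, 0 < δ ∧ ∀ x y : X,
      (∀ t : ℝ, dist (φ t x) (φ t y) < δ) → ∃ s ∈ Ioo (-ε) ε, y = φ s x

/-- The forward-time version of kinematic expansiveness: closeness of the two orbits is required
only at positive times. -/
def IsForwardKinematicExpansive {X : Type*} [τ : TopologicalSpace X] (φ : Flow ℝ X) : Prop :=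
  ∀ m : MetricSpace X, m.toPseudoMetricSpace.toUniformSpace.toTopologicalSpace = τ →
    ∀ ε : ℝ, 0 < ε → ∃ δ : ℝ, 0 < δ ∧ ∀ x y : X,
      (∀ t : ℝ, 0 < t → dist (φ t x) (φ t y) < δ) → ∃ s ∈ Ioo (-ε) ε, y = φ s x

section Suspension

variable {Y : Type*} [TopologicalSpace Y]

/-- The homeomorphism `F (x, t) = (f x, t - T x)` of `Y × ℝ`. -/
def suspensionDeck (f : Y ≃ₜ Y) (T : C(Y, ℝ)) : (Y × ℝ) ≃ₜ (Y × ℝ) where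
  toFun p := (f p.1, p.2 - T p.1)
  invFun p := (f.symm p.1, p.2 + T (f.symm p.1))
  left_inv p := by simp
  right_inv p := by simp
  continuous_toFun := by fun_prop
  continuous_invFun := by fun_prop

/-- Two points of `Y × ℝ` are equivalent if they lie in the same orbit of the infinite cyclic group
generated by `F`. -/
def suspensionSetoid (f : Y ≃ₜ Y) (T : C(Y, ℝ)) : Setoid (Y × ℝ) where
  r p q := ∃ n : ℤ, (suspensionDeck f T ^ n) p = q
  iseqv :=
    { refl := fun p => ⟨0, by simp⟩
      symm := by
        rintro p q ⟨n, rfl⟩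
        exact ⟨-n, by rw [← Homeomorph.mul_apply, ← zpow_add]; simp⟩
      trans := by
        rintro p q r ⟨n, rfl⟩ ⟨m, rfl⟩
        exact ⟨m + n, by rw [zpow_add, Homeomorph.mul_apply]⟩ }

/-- The phase space `⟨F⟩ \ (Y × ℝ)` of the suspension, with the quotient topology. -/
def SuspensionSpace (f : Y ≃ₜ Y) (T : C(Y, ℝ)) : Type _ :=
  Quotient (suspensionSetoid f T)

instance SuspensionSpace.instTopologicalSpace (f : Y ≃ₜ Y) (T : C(Y, ℝ)) :
    TopologicalSpace (SuspensionSpace f T) :=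
  instTopologicalSpaceQuotient (s := suspensionSetoid f T)

/-- The canonical projection from `Y × ℝ`. -/
def SuspensionSpace.mk (f : Y ≃ₜ Y) (T : C(Y, ℝ)) (p : Y × ℝ) : SuspensionSpace f T :=
  Quotient.mk (suspensionSetoid f T) p

/-- The vertical translation by `t` on `Y × ℝ`. -/
def verticalTranslation (t : ℝ) (p : Y × ℝ) : Y × ℝ := (p.1, p.2 + t)

theorem suspensionDeck_verticalTranslation (f : Y ≃ₜ Y) (T : C(Y, ℝ)) (t : ℝ) (p : Y × ℝ) :
    suspensionDeck f T (verticalTranslation t p) =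
      verticalTranslation t (suspensionDeck f T p) := by
  change (f p.1, p.2 + t - T p.1) = (f p.1, p.2 - T p.1 + t)
  rw [sub_add_eq_add_sub]

theorem suspensionDeck_zpow_verticalTranslation (f : Y ≃ₜ Y) (T : C(Y, ℝ)) (n : ℤ) (t : ℝ)
    (p : Y × ℝ) :
    (suspensionDeck f T ^ n) (verticalTranslation t p) =
      verticalTranslation t ((suspensionDeck f T ^ n) p) := by
  induction n generalizing p with
  | zero => simp
  | succ n ih =>
    rw [zpow_add_one, Homeomorph.mul_apply, Homeomorph.mul_apply,
      suspensionDeck_verticalTranslation, ih]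
  | pred n ih =>
    have h : (suspensionDeck f T)⁻¹ (verticalTranslation t p) =
        verticalTranslation t ((suspensionDeck f T)⁻¹ p) := by
      apply (suspensionDeck f T).injective
      rw [suspensionDeck_verticalTranslation, ← Homeomorph.mul_apply, ← Homeomorph.mul_apply,
        mul_inv_cancel]
      rfl
    rw [zpow_sub_one, Homeomorph.mul_apply, Homeomorph.mul_apply, h, ih]

theorem SuspensionSpace.isOpenQuotientMap_mk (f : Y ≃ₜ Y) (T : C(Y, ℝ)) :
    IsOpenQuotientMap (SuspensionSpace.mk f T) := by
  refine ⟨Quotient.mk_surjective, continuous_quot_mk, fun U hU => ?_⟩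
  have h : SuspensionSpace.mk f T ⁻¹' (SuspensionSpace.mk f T '' U) =
      ⋃ n : ℤ, (suspensionDeck f T ^ n) ⁻¹' U := by
    ext p
    simp only [mem_preimage, mem_image, mem_iUnion]
    constructor
    · rintro ⟨q, hq, hqp⟩
      obtain ⟨n, hn⟩ := (suspensionSetoid f T).symm (Quotient.exact hqp)
      exact ⟨n, by rw [hn]; exact hq⟩
    · rintro ⟨n, hn⟩
      exact ⟨_, hn, Quotient.sound ((suspensionSetoid f T).symm ⟨n, rfl⟩)⟩
  change IsOpen (SuspensionSpace.mk f T ⁻¹' (SuspensionSpace.mk f T '' U))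
  rw [h]
  exact isOpen_iUnion fun n => hU.preimage (suspensionDeck f T ^ n).continuous

/-- The suspension flow of `f` with return time `T`, induced on the quotient by the vertical
translation flow of `Y × ℝ`. -/
def suspensionFlow (f : Y ≃ₜ Y) (T : C(Y, ℝ)) : Flow ℝ (SuspensionSpace f T) where
  toFun t := Quotient.map' (s₁ := suspensionSetoid f T) (s₂ := suspensionSetoid f T)
    (verticalTranslation t) (by
      rintro p q ⟨n, rfl⟩
      exact ⟨n, suspensionDeck_zpow_verticalTranslation f T n t p⟩)
  cont' := by
    have hq : IsOpenQuotientMap (Prod.map (id : ℝ → ℝ) (SuspensionSpace.mk f T)) :=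
      IsOpenQuotientMap.id.prodMap (SuspensionSpace.isOpenQuotientMap_mk f T)
    refine hq.isQuotientMap.continuous_iff.2 ?_
    have hc : Continuous fun z : ℝ × (Y × ℝ) => verticalTranslation z.1 z.2 := by
      unfold verticalTranslation
      fun_prop
    exact (SuspensionSpace.isOpenQuotientMap_mk f T).continuous.comp hc
  map_add' t₁ t₂ x := by
    induction x using Quotient.inductionOn with
    | h p =>
      refine congrArg (Quotient.mk (suspensionSetoid f T)) ?_
      simp only [verticalTranslation, Prod.mk.injEq, true_and]
      ring
  map_zero' x := by
    induction x using Quotient.inductionOn with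
    | h p =>
      refine congrArg (Quotient.mk (suspensionSetoid f T)) ?_
      simp [verticalTranslation]

end Suspension

/-- The rotation `x ↦ x + α` of the circle `ℝ / ℤ`. -/
def circleRotation (α : ℝ) : UnitAddCircle ≃ₜ UnitAddCircle :=
  Homeomorph.addRight (α : UnitAddCircle)

end

/-! Let `α > 0` solve `α ^ 2 + a * α = 1`, let `q_j` be the denominators of its convergents, and
take `T = 3 + ∑ α ^ j cos (2 π q_j x)`. The weights `α ^ j` are summable, so `T` is continuous, yet
they exceed the small divisors `‖q_j α‖ ≤ α ^ (j + 1)` by a factor `1 / α`.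

Two forward orbits of the flow that stay close cross the section together. This yields base points
`x` and `x + h` whose Birkhoff sums differ by less than a fixed `c` at all times
(`isForwardKinematicExpansive_of_birkhoffSum`). By the cocycle identity and minimality of the
rotation, the bound `2 c` then holds on the whole circle. The `k`-th Fourier coefficient of the
difference of the `n`-th sums is, up to sign, `T̂(k) (e(k h) - 1) (e(n k α) - 1) / (e(k α) - 1)`.
Choosing `n` with `|e(n k α) - 1| ≥ 1 / 2` gives `|T̂(k)| |e(k h) - 1| ≤ 4 c |e(k α) - 1|`
(`norm_fourierCoeff_mul_le_of_orbit`).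

For `k = q_j` this says that `‖q_j h‖` is at most a small multiple of `α`, uniformly in `j`. Since
`q_{j+2} = a q_{j+1} + q_j` and `a α < 1`, the multiples `q_j h` never have room to wrap around the
circle, which forces `h = 0` (`eq_zero_of_norm_metallicDenom_nsmul_le`). -/

noncomputable section

/-! ### The return cocycle and the topology of the suspension -/

section SuspensionDynamics

variable {Y : Type*} [TopologicalSpace Y] (f : Y ≃ₜ Y) (T : C(Y, ℝ))

/-- The additive cocycle `S_n T`, `n ∈ ℤ`, of the return time: the `n`-th power of the deck
transformation lowers the fibre over `x` by `S_n T x`. -/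
def returnCocycle (n : ℤ) (x : Y) : ℝ := -((suspensionDeck f T ^ n) (x, 0)).2

theorem suspensionDeck_zpow_apply_fst (n : ℤ) (p : Y × ℝ) :
    ((suspensionDeck f T ^ n) p).1 = (f ^ n) p.1 := by
  induction n generalizing p with
  | zero => simp
  | succ n ih => rw [zpow_add_one, Homeomorph.mul_apply, ih, zpow_add_one]; rfl
  | pred n ih => rw [zpow_sub_one, Homeomorph.mul_apply, ih, zpow_sub_one]; rfl

theorem suspensionDeck_zpow_apply (n : ℤ) (p : Y × ℝ) :
    (suspensionDeck f T ^ n) p = ((f ^ n) p.1, p.2 - returnCocycle f T n p.1) := by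
  refine Prod.ext (suspensionDeck_zpow_apply_fst f T n p) ?_
  have h := suspensionDeck_zpow_verticalTranslation f T n p.2 (p.1, 0)
  have hp : verticalTranslation p.2 (p.1, (0 : ℝ)) = p := by simp [verticalTranslation]
  rw [hp] at h
  rw [h]
  simp only [verticalTranslation, returnCocycle]
  ring

theorem returnCocycle_add (m n : ℤ) (x : Y) :
    returnCocycle f T (m + n) x = returnCocycle f T n x + returnCocycle f T m ((f ^ n) x) := by
  have h : (suspensionDeck f T ^ (m + n)) (x, 0) =
      (suspensionDeck f T ^ m) ((suspensionDeck f T ^ n) (x, 0)) := by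
    rw [zpow_add, Homeomorph.mul_apply]
  simp only [suspensionDeck_zpow_apply, Prod.mk.injEq] at h
  linarith [h.2]

@[simp] theorem returnCocycle_zero (x : Y) : returnCocycle f T 0 x = 0 := by
  simp [returnCocycle]

@[simp] theorem returnCocycle_one (x : Y) : returnCocycle f T 1 x = T x := by
  simp [returnCocycle, suspensionDeck]

theorem homeomorph_zpow_natCast_apply (n : ℕ) (x : Y) : (f ^ (n : ℤ)) x = f^[n] x := by
  induction n generalizing x with
  | zero => simp
  | succ n ih =>
    rw [Function.iterate_succ_apply, ← ih, Nat.cast_succ, zpow_add_one]; rfl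

theorem returnCocycle_natCast (n : ℕ) (x : Y) :
    returnCocycle f T n x = birkhoffSum f T n x := by
  induction n with
  | zero => simp
  | succ n ih =>
    rw [birkhoffSum_succ, ← ih, Nat.cast_succ, add_comm (n : ℤ), returnCocycle_add,
      homeomorph_zpow_natCast_apply, returnCocycle_one]

variable {f T}

theorem mul_le_returnCocycle_natCast {m : ℝ} (hT : ∀ x, m ≤ T x) (n : ℕ) (x : Y) :
    n * m ≤ returnCocycle f T n x := by
  rw [returnCocycle_natCast, birkhoffSum]
  simpa using Finset.card_nsmul_le_sum (Finset.range n) (fun k => T (f^[k] x)) m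
    (fun k _ => hT _)

theorem abs_mul_le_abs_returnCocycle {m : ℝ} (hT : ∀ x, m ≤ T x) (n : ℤ) (x : Y) :
    |(n : ℝ)| * m ≤ |returnCocycle f T n x| := by
  obtain ⟨k, rfl | rfl⟩ := n.eq_nat_or_neg
  · simpa using (mul_le_returnCocycle_natCast hT k x).trans (le_abs_self _)
  · have h := returnCocycle_add f T k (-k) x
    rw [add_neg_cancel, returnCocycle_zero] at h
    have h' := mul_le_returnCocycle_natCast (f := f) hT k ((f ^ (-(k : ℤ))) x)
    have := neg_le_abs (returnCocycle f T (-k) x)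
    simp only [Int.cast_neg, Int.cast_natCast, abs_neg, Nat.abs_cast]
    linarith

theorem eq_zero_of_abs_returnCocycle_lt {m : ℝ} (hT : ∀ x, m ≤ T x) (hm : 0 < m) {n : ℤ} {x : Y}
    (h : |returnCocycle f T n x| < m) : n = 0 := by
  by_contra hn
  have h1 : (1 : ℝ) ≤ |(n : ℝ)| := by exact_mod_cast Int.one_le_abs hn
  have := abs_mul_le_abs_returnCocycle (f := f) hT n x
  nlinarith

theorem SuspensionSpace.mk_eq_mk {p q : Y × ℝ} :
    SuspensionSpace.mk f T p = SuspensionSpace.mk f T q ↔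
      ∃ n : ℤ, (suspensionDeck f T ^ n) p = q :=
  Quotient.eq (r := suspensionSetoid f T)

theorem SuspensionSpace.mk_zpow (n : ℤ) (p : Y × ℝ) :
    SuspensionSpace.mk f T ((suspensionDeck f T ^ n) p) = SuspensionSpace.mk f T p :=
  (SuspensionSpace.mk_eq_mk.2 ⟨n, rfl⟩).symm

theorem suspensionFlow_mk (t : ℝ) (p : Y × ℝ) :
    suspensionFlow f T t (SuspensionSpace.mk f T p) = SuspensionSpace.mk f T (p.1, p.2 + t) :=
  rfl

variable (f) in
/-- Every point of the suspension has a representative whose height lies in `[b - M, b)`, for any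
`b` and any upper bound `M` of the return time. -/
theorem exists_zpow_snd_mem_Ico {m M : ℝ} (hm : 0 < m) (hT : ∀ x, m ≤ T x) (hM : ∀ x, T x ≤ M)
    (p : Y × ℝ) (b : ℝ) :
    ∃ n : ℤ, ((suspensionDeck f T ^ n) p).2 ∈ Ico (b - M) b := by
  have hdown : ∀ q : Y × ℝ, ∃ n : ℤ, ((suspensionDeck f T ^ n) q).2 < b := by
    intro q
    obtain ⟨k, hk⟩ := exists_nat_gt ((q.2 - b) / m)
    refine ⟨k, ?_⟩
    rw [suspensionDeck_zpow_apply]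
    have := mul_le_returnCocycle_natCast (f := f) hT k q.1
    rw [div_lt_iff₀ hm] at hk
    change q.2 - _ < b
    linarith
  obtain ⟨n₀, hn₀⟩ := hdown p
  obtain ⟨n, hn, hmin⟩ := Int.exists_least_of_bdd
    (P := fun n : ℤ => ((suspensionDeck f T ^ n) p).2 < b) (by
      obtain ⟨k, hk⟩ := exists_nat_gt ((b - p.2) / m)
      refine ⟨-k, fun z hz => ?_⟩
      by_contra! hlt
      rw [suspensionDeck_zpow_apply] at hz
      change p.2 - _ < b at hz
      obtain ⟨l, rfl⟩ : ∃ l : ℕ, z = -l := ⟨(-z).toNat, by omega⟩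
      have h := returnCocycle_add f T l (-l) p.1
      rw [add_neg_cancel, returnCocycle_zero] at h
      have h' := mul_le_returnCocycle_natCast (f := f) hT l ((f ^ (-(l : ℤ))) p.1)
      rw [div_lt_iff₀ hm] at hk
      have hkl : (k : ℝ) ≤ l := by
        have : k ≤ l := by omega
        exact_mod_cast this
      nlinarith) ⟨n₀, hn₀⟩
  refine ⟨n, ?_, hn⟩
  -- Otherwise undoing one deck step raises the height by at most `M` and keeps it below `b`,
  -- against minimality of `n`.
  by_contra! hlt
  have := hmin (n - 1) (by
    have h := returnCocycle_add f T 1 (n - 1) p.1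
    rw [add_sub_cancel, returnCocycle_one] at h
    rw [suspensionDeck_zpow_apply] at hlt ⊢
    change p.2 - _ < b
    change p.2 - _ < b - M at hlt
    linarith [hM ((f ^ (n - 1)) p.1)])
  omega

theorem SuspensionSpace.compactSpace [CompactSpace Y] (hT : ∀ x, 0 < T x) :
    CompactSpace (SuspensionSpace f T) := by
  rcases isEmpty_or_nonempty Y with hY | hY
  · have : IsEmpty (SuspensionSpace f T) :=
      ⟨fun x => Quotient.inductionOn x fun p => hY.false p.1⟩
    infer_instance
  obtain ⟨x₀, hx₀⟩ := T.continuous.exists_forall_le_of_hasCompactSupport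
    (HasCompactSupport.of_compactSpace _)
  obtain ⟨x₁, hx₁⟩ := T.continuous.exists_forall_ge_of_hasCompactSupport
    (HasCompactSupport.of_compactSpace _)
  have hK : IsCompact ((univ : Set Y) ×ˢ Icc (0 - T x₁) 0) := isCompact_univ.prod isCompact_Icc
  refine ⟨(hK.image (SuspensionSpace.isOpenQuotientMap_mk f T).continuous).of_isClosed_subset
    isClosed_univ fun x _ => ?_⟩
  induction x using Quotient.inductionOn with
  | h p =>
    obtain ⟨n, hn⟩ := exists_zpow_snd_mem_Ico f (hT x₀) hx₀ hx₁ p 0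
    exact ⟨_, ⟨mem_univ _, Ico_subset_Icc_self hn⟩, SuspensionSpace.mk_zpow n p⟩

/-- The orbit relation is the union of the graphs of the deck powers. The `n`-th power moves heights
by at least `|n| * m`, so this union is locally finite, hence closed. -/
theorem SuspensionSpace.t2Space [T2Space Y] {m : ℝ} (hm : 0 < m) (hT : ∀ x, m ≤ T x) :
    T2Space (SuspensionSpace f T) := by
  rw [t2Space_iff_of_isOpenQuotientMap (SuspensionSpace.isOpenQuotientMap_mk f T)]
  have heq : {q : (Y × ℝ) × (Y × ℝ) | SuspensionSpace.mk f T q.1 = SuspensionSpace.mk f T q.2} =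
      ⋃ n : ℤ, {q | (suspensionDeck f T ^ n) q.1 = q.2} := by
    ext q
    simp [SuspensionSpace.mk_eq_mk]
  rw [heq]
  refine LocallyFinite.isClosed_iUnion ?_ fun n =>
    isClosed_eq ((suspensionDeck f T ^ n).continuous.comp continuous_fst) continuous_snd
  intro q
  refine ⟨{r | |r.1.2 - r.2.2| < |q.1.2 - q.2.2| + 1}, ?_, ?_⟩
  · exact (isOpen_lt (by fun_prop) continuous_const).mem_nhds (by simp)
  · obtain ⟨k, hk⟩ := exists_nat_gt ((|q.1.2 - q.2.2| + 1) / m)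
    refine (Set.finite_Icc (-(k : ℤ)) k).subset ?_
    rintro n ⟨r, hr, hr'⟩
    simp only [mem_ofPred_eq] at hr hr'
    rw [suspensionDeck_zpow_apply] at hr
    rw [← hr] at hr'
    simp only [sub_sub_cancel] at hr'
    have h := abs_mul_le_abs_returnCocycle (f := f) hT n r.1.1
    rw [div_lt_iff₀ hm] at hk
    have hlt : |(n : ℝ)| < k := lt_of_mul_lt_mul_right (by linarith) hm.le
    have : |n| < (k : ℤ) := by exact_mod_cast hlt
    exact abs_le.1 this.le

end SuspensionDynamics

/-! ### From Birkhoff sums to expansiveness of the flow -/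

section SuspensionExpansive

variable {Y : Type*} [MetricSpace Y] [CompactSpace Y] {f : Y ≃ₜ Y} {T : C(Y, ℝ)}

theorem SuspensionSpace.metrizableSpace {m : ℝ} (hm : 0 < m) (hT : ∀ x, m ≤ T x) :
    TopologicalSpace.MetrizableSpace (SuspensionSpace f T) := by
  have := SuspensionSpace.t2Space (f := f) hm hT
  have := SuspensionSpace.compactSpace (f := f) (T := T) fun x => hm.trans_le (hT x)
  have hq := SuspensionSpace.isOpenQuotientMap_mk f T
  have := hq.isQuotientMap.secondCountableTopology hq.isOpenMap
  exact TopologicalSpace.metrizableSpace_of_t3_secondCountable _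

theorem lebesgue_number_lemma_of_inducing_metric {X ι : Type*} [τ : TopologicalSpace X]
    (M : MetricSpace X) (hM : M.toPseudoMetricSpace.toUniformSpace.toTopologicalSpace = τ)
    {s : Set X} {c : ι → Set X} (hs : IsCompact s) (hc₁ : ∀ i, IsOpen (c i))
    (hc₂ : s ⊆ ⋃ i, c i) : ∃ δ > 0, ∀ x ∈ s, ∃ i, ∀ y, dist x y < δ → y ∈ c i := by
  subst hM
  simpa [subset_def, Metric.mem_ball, dist_comm] using lebesgue_number_lemma_of_metric hs hc₁ hc₂

/-- Points of the suspension that are close to the section at height `0` have representatives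
close to the section. -/
theorem SuspensionSpace.exists_forall_dist_section_lt {m : ℝ} (hm : 0 < m) (hT : ∀ x, m ≤ T x)
    (M : MetricSpace (SuspensionSpace f T))
    (hM : M.toPseudoMetricSpace.toUniformSpace.toTopologicalSpace =
      SuspensionSpace.instTopologicalSpace f T) {η : ℝ} (hη : 0 < η) :
    ∃ δ > 0, ∀ (z : Y) (q : Y × ℝ),
      dist (SuspensionSpace.mk f T (z, 0)) (SuspensionSpace.mk f T q) < δ →
        ∃ k : ℤ, dist ((suspensionDeck f T ^ k) q) (z, 0) < η := by
  set η' := min η m with hη'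
  have hη'0 : 0 < η' := lt_min hη hm
  have hq := SuspensionSpace.isOpenQuotientMap_mk f T
  obtain ⟨δ, hδ, H⟩ := lebesgue_number_lemma_of_inducing_metric M hM
    ((isCompact_univ.prod isCompact_singleton).image hq.continuous
      (s := (univ : Set Y) ×ˢ {(0 : ℝ)}))
    (c := fun w : Y => SuspensionSpace.mk f T '' Metric.ball (w, (0 : ℝ)) (η' / 2))
    (fun w => hq.isOpenMap _ Metric.isOpen_ball) (by
      rintro _ ⟨⟨w, r⟩, ⟨-, hr⟩, rfl⟩
      obtain rfl : r = 0 := hr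
      exact mem_iUnion.2 ⟨w, mem_image_of_mem _ (Metric.mem_ball_self (by positivity))⟩)
  refine ⟨δ, hδ, fun z q hzq => ?_⟩
  obtain ⟨w, hw⟩ := H _ (mem_image_of_mem _ (show (z, (0 : ℝ)) ∈ univ ×ˢ {(0 : ℝ)} by simp))
  obtain ⟨z', hz', hzz'⟩ := hw _ ((dist_self _).trans_lt hδ)
  obtain ⟨q', hq', hqq'⟩ := hw _ hzq
  obtain ⟨j, rfl⟩ := SuspensionSpace.mk_eq_mk.1 hzz'.symm
  obtain ⟨k, rfl⟩ := SuspensionSpace.mk_eq_mk.1 hqq'.symm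
  -- A ball of radius below `m` around the section holds no other lift of `(z, 0)`: a nontrivial
  -- deck power changes the height by at least `m`.
  obtain rfl : j = 0 := by
    refine eq_zero_of_abs_returnCocycle_lt (f := f) (x := z) hT hm ?_
    rw [suspensionDeck_zpow_apply, Metric.mem_ball, Prod.dist_eq, max_lt_iff] at hz'
    have := hz'.2
    simp only [zero_sub, Real.dist_eq, sub_zero, abs_neg] at this
    linarith [min_le_right η m]
  refine ⟨k, (dist_triangle_right _ _ (w, (0 : ℝ))).trans_lt ?_⟩
  rw [zpow_zero] at hz'
  have h1 := Metric.mem_ball.1 hz'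
  have h2 := Metric.mem_ball.1 hq'
  change dist (z, (0 : ℝ)) _ < _ at h1
  linarith [min_le_left η m]

/-- If the Birkhoff sums of the return time separate nearby points by a uniform constant, the
suspension flow is expansive in forward time: two orbits which stay close are compared at the
times when the first one hits the section. -/
theorem isForwardKinematicExpansive_of_birkhoffSum {m c : ℝ} (hm : 0 < m) (hT : ∀ x, m ≤ T x)
    (hc : 0 < c)
    (H : ∀ x y, dist x y < c → (∀ n : ℕ, |birkhoffSum f T n x - birkhoffSum f T n y| < c) → x = y) :
    IsForwardKinematicExpansive (suspensionFlow f T) := by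
  intro M hM ε hε
  obtain ⟨ρ, hρ, hTρ⟩ := Metric.uniformContinuous_iff.1
    (CompactSpace.uniformContinuous_of_continuous T.continuous) (m / 2) (by positivity)
  -- Two errors `η` plus the oscillation `m / 2` of `T` must stay below `m`, two errors `η` below
  -- `c`, and one error bounds the final time shift by `ε`.
  obtain ⟨η, hη, hηε, hηm, hηρ, hηc⟩ : ∃ η > 0, η < ε ∧ η < m / 4 ∧ η < ρ ∧ η < c / 2 := by
    have hpos : 0 < min (min ε (m / 4)) (min ρ (c / 2)) := by positivity
    refine ⟨min (min ε (m / 4)) (min ρ (c / 2)) / 2, by positivity, ?_⟩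
    have h := half_lt_self hpos
    simp only [lt_min_iff] at h
    exact ⟨h.1.1, h.1.2, h.2.1, h.2.2⟩
  obtain ⟨δ, hδ, Hδ⟩ := SuspensionSpace.exists_forall_dist_section_lt hm hT M hM hη
  refine ⟨δ, hδ, fun p q hpq => ?_⟩
  obtain ⟨M', hM'⟩ : ∃ M', ∀ x, T x ≤ M' := by
    obtain ⟨b, hb⟩ := (isCompact_range T.continuous).bddAbove
    exact ⟨b, fun x => hb (mem_range_self x)⟩
  induction p using Quotient.inductionOn with | h p
  induction q using Quotient.inductionOn with | h q
  change ∀ t, 0 < t → dist (suspensionFlow f T t (SuspensionSpace.mk f T p))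
    (suspensionFlow f T t (SuspensionSpace.mk f T q)) < δ at hpq
  change ∃ s ∈ Ioo (-ε) ε, SuspensionSpace.mk f T q =
    suspensionFlow f T s (SuspensionSpace.mk f T p)
  -- A strictly negative height makes every crossing time used below positive, including the one for
  -- `n = 0`.
  obtain ⟨N, hN⟩ := exists_zpow_snd_mem_Ico f hm hT hM' p 0
  rw [← SuspensionSpace.mk_zpow N p] at hpq ⊢
  generalize (suspensionDeck f T ^ N) p = p at hN hpq ⊢
  obtain ⟨x, s⟩ := p
  obtain ⟨y, r⟩ := q
  have hs : s < 0 := hN.2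
  simp only [suspensionFlow_mk] at hpq ⊢
  -- At time `birkhoffSum f T n x - s` the first orbit meets the section at `f^[n] x`; `k` indexes
  -- the nearby lift of the second orbit.
  have key : ∀ n : ℕ, ∃ k : ℤ, dist ((f ^ k) y) (f^[n] x) < η ∧
      |r - s + birkhoffSum f T n x - returnCocycle f T k y| < η := by
    intro n
    have hn : 0 < birkhoffSum f T n x - s := by
      have := mul_le_returnCocycle_natCast (f := f) hT n x
      rw [returnCocycle_natCast] at this
      have h0 : 0 ≤ n * m := by positivity
      linarith
    have h := hpq _ hn
    rw [← SuspensionSpace.mk_zpow n (x, _), suspensionDeck_zpow_apply, returnCocycle_natCast,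
      homeomorph_zpow_natCast_apply] at h
    simp only [add_sub_cancel, sub_self] at h
    obtain ⟨k, hk⟩ := Hδ _ _ h
    refine ⟨k, ?_⟩
    rw [suspensionDeck_zpow_apply, Prod.dist_eq, max_lt_iff] at hk
    refine ⟨hk.1, ?_⟩
    have := hk.2
    simp only [Real.dist_eq, sub_zero] at this
    rwa [show r - s + birkhoffSum f T n x - returnCocycle f T k y =
      r + (birkhoffSum f T n x - s) - returnCocycle f T k y by ring]
  choose k hk1 hk2 using key
  -- Over one return of each orbit the elapsed times agree to within less than `m`, so no return is
  -- skipped or repeated.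
  have hstep : ∀ n, k (n + 1) = k n + 1 := by
    intro n
    suffices k (n + 1) - (k n + 1) = 0 by omega
    refine eq_zero_of_abs_returnCocycle_lt (f := f) (x := (f ^ (k n + 1)) y) hT hm ?_
    have e1 := returnCocycle_add f T (k (n + 1) - (k n + 1)) (k n + 1) y
    have e2 := returnCocycle_add f T 1 (k n) y
    rw [sub_add_cancel] at e1
    rw [returnCocycle_one, add_comm 1] at e2
    have e3 := birkhoffSum_succ f T n x
    have b1 := abs_lt.1 (hk2 n)
    have b2 := abs_lt.1 (hk2 (n + 1))
    have b3 := hTρ ((hk1 n).trans hηρ)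
    rw [Real.dist_eq, abs_lt] at b3
    rw [abs_lt]
    constructor <;> linarith [b1.1, b1.2, b2.1, b2.2, b3.1, b3.2]
  have hk : ∀ n : ℕ, k n = n + k 0 := by
    intro n
    induction n with
    | zero => simp
    | succ n ih => rw [hstep, ih]; push_cast; ring
  have b0 := hk2 0
  simp only [birkhoffSum_zero, add_zero] at b0
  obtain rfl : x = (f ^ k 0) y := by
    refine H _ _ ?_ fun n => ?_
    · have := hk1 0
      rw [dist_comm] at this
      simp only [Function.iterate_zero, id] at this
      linarith
    · have b1 := hk2 n
      rw [hk, returnCocycle_add, returnCocycle_natCast] at b1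
      rw [abs_lt] at b0 b1 ⊢
      constructor <;> linarith [b0.1, b0.2, b1.1, b1.2]
  refine ⟨r - returnCocycle f T (k 0) y - s, ?_, ?_⟩
  · rw [abs_lt] at b0
    constructor <;> linarith [b0.1, b0.2]
  · rw [SuspensionSpace.mk_eq_mk]
    refine ⟨k 0, ?_⟩
    rw [suspensionDeck_zpow_apply]
    exact Prod.ext rfl (by simp)

end SuspensionExpansive

theorem IsForwardKinematicExpansive.isKinematicExpansive {X : Type*} [TopologicalSpace X]
    {φ : Flow ℝ X} (h : IsForwardKinematicExpansive φ) : IsKinematicExpansive φ :=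
  fun M hM ε hε => (h M hM ε hε).imp fun _ hδ => ⟨hδ.1, fun x y hxy => hδ.2 x y fun t _ => hxy t⟩

theorem UnitAddCircle.exists_coe_eq_abs_le_half (x : UnitAddCircle) :
    ∃ r : ℝ, (r : UnitAddCircle) = x ∧ |r| ≤ 1 / 2 := by
  obtain ⟨y, rfl⟩ := QuotientAddGroup.mk_surjective x
  refine ⟨y - round y, ?_, abs_sub_round y⟩
  rw [AddCircle.coe_sub, sub_eq_self]
  exact (AddCircle.coe_eq_zero_iff 1).2 ⟨round y, by simp⟩

/-! ### Arithmetic of `[0; a, a, a, …]` -/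

section MetallicMean

/-- The denominators of the convergents of the continued fraction `[0; a, a, a, …]`. -/
def metallicDenom (a : ℕ) : ℕ → ℕ
  | 0 => 1
  | 1 => a
  | n + 2 => a * metallicDenom a (n + 1) + metallicDenom a n

theorem succ_le_metallicDenom {a : ℕ} (ha : 2 ≤ a) (n : ℕ) : n + 1 ≤ metallicDenom a n := by
  induction n using Nat.twoStepInduction with
  | zero => simp [metallicDenom]
  | one => simpa [metallicDenom] using ha
  | more n h0 h1 => rw [metallicDenom]; nlinarith

theorem exists_pos_sq_add_mul_eq_one (a : ℕ) : ∃ α : ℝ, 0 < α ∧ α ^ 2 + a * α = 1 := by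
  have h := Real.sq_sqrt (show (0 : ℝ) ≤ a ^ 2 + 4 by positivity)
  refine ⟨(√((a : ℝ) ^ 2 + 4) - a) / 2, ?_, by nlinarith⟩
  have : (a : ℝ) < √((a : ℝ) ^ 2 + 4) := Real.lt_sqrt_of_sq_lt (by linarith)
  linarith

variable {a : ℕ} {α : ℝ}

theorem mul_lt_one_of_sq_add_mul_eq_one (hα : 0 < α) (h : α ^ 2 + a * α = 1) : a * α < 1 := by
  nlinarith

theorem lt_one_of_sq_add_mul_eq_one (ha : 1 ≤ a) (hα : 0 < α) (h : α ^ 2 + a * α = 1) :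
    α < 1 := by
  have : (1 : ℝ) ≤ a := by exact_mod_cast ha
  nlinarith

theorem floor_eq_zero_of_sq_add_mul_eq_one (ha : 1 ≤ a) (hα : 0 < α) (h : α ^ 2 + a * α = 1) :
    ⌊α⌋ = 0 :=
  Int.floor_eq_zero_iff.2 ⟨hα.le, lt_one_of_sq_add_mul_eq_one ha hα h⟩

/-- Since `1 / α = a + α` with `0 < α < 1`, the Gauss map fixes `α` and each step produces the digit
`a`. -/
theorem genContFract_get?_of_sq_add_mul_eq_one (ha : 1 ≤ a) (hα : 0 < α)
    (h : α ^ 2 + a * α = 1) (n : ℕ) : (GenContFract.of α).s.get? n = some ⟨1, (a : ℝ)⟩ := by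
  have h1 := lt_one_of_sq_add_mul_eq_one ha hα h
  have hinv : α⁻¹ = α + (a : ℤ) := by
    refine inv_eq_of_mul_eq_one_right ?_
    push_cast
    linarith
  have hfr : Int.fract α = α := Int.fract_eq_self.2 ⟨hα.le, h1⟩
  have hs : ∀ n, GenContFract.IntFractPair.stream (α + (a : ℤ)) n = some ⟨a, α⟩ := by
    have hof : GenContFract.IntFractPair.of (α + (a : ℤ)) = ⟨a, α⟩ := by
      simp [GenContFract.IntFractPair.of, hfr, Int.floor_eq_zero_iff.2 ⟨hα.le, h1⟩]
    intro n
    induction n with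
    | zero => rw [GenContFract.IntFractPair.stream_zero, hof]
    | succ n ih =>
      rw [GenContFract.IntFractPair.stream_succ_of_some ih hα.ne']
      simp only [hinv, hof]
  have := GenContFract.get?_of_eq_some_of_succ_get?_intFractPair_stream (v := α) (n := n)
    (ifp_succ_n := ⟨a, α⟩) (by
      rw [GenContFract.IntFractPair.stream_succ (by rw [hfr]; exact hα.ne'), hfr, hinv, hs])
  simpa using this

theorem irrational_of_sq_add_mul_eq_one (ha : 1 ≤ a) (hα : 0 < α) (h : α ^ 2 + a * α = 1) :
    Irrational α := by
  rintro ⟨r, hr⟩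
  obtain ⟨n, hn⟩ := (GenContFract.terminates_iff_rat α).2 ⟨r, hr.symm⟩
  rw [Stream'.Seq.TerminatedAt, genContFract_get?_of_sq_add_mul_eq_one ha hα h] at hn
  cases hn

/-- The number `-α` is a root of `X ^ 2 = a * X + 1`, so its powers obey the recurrence of the
denominators. -/
theorem exists_metallicDenom_mul_sub (h : α ^ 2 + a * α = 1) (n : ℕ) :
    ∃ p : ℤ, metallicDenom a n * α - p = -(-α) ^ (n + 1) := by
  induction n using Nat.twoStepInduction with
  | zero => exact ⟨0, by simp [metallicDenom]⟩
  | one => exact ⟨1, by simp only [metallicDenom]; push_cast; linarith⟩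
  | more n h0 h1 =>
    obtain ⟨p, hp⟩ := h0
    obtain ⟨r, hr⟩ := h1
    refine ⟨a * r + p, ?_⟩
    rw [metallicDenom]
    push_cast
    have : (-α) ^ (n + 2 + 1) = (-α) ^ (n + 1) * (1 - a * α) := by
      rw [show 1 - a * α = (-α) ^ 2 by linarith]; ring
    rw [this]
    have hr' : (-α) ^ (n + 1 + 1) = (-α) ^ (n + 1) * (-α) := pow_succ _ _
    rw [hr'] at hr
    linear_combination (a : ℝ) * hr + hp

theorem norm_metallicDenom_nsmul_le (hα : 0 < α) (h : α ^ 2 + a * α = 1) (n : ℕ) :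
    ‖metallicDenom a n • (α : UnitAddCircle)‖ ≤ α ^ (n + 1) := by
  obtain ⟨p, hp⟩ := exists_metallicDenom_mul_sub h n
  have : metallicDenom a n • (α : UnitAddCircle) = ((-(-α) ^ (n + 1) : ℝ) : UnitAddCircle) := by
    rw [← hp, AddCircle.coe_sub, ← nsmul_eq_mul, AddCircle.coe_nsmul, eq_comm, sub_eq_self]
    exact (AddCircle.coe_eq_zero_iff 1).2 ⟨p, by simp⟩
  rw [this]
  rw [UnitAddCircle.norm_eq]
  refine (round_le _ 0).trans_eq ?_
  simp [abs_of_pos hα]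

/-- A point of the circle is zero if all its multiples by the denominators are small. -/
theorem eq_zero_of_norm_metallicDenom_nsmul_le {ρ : ℝ} (ha : 2 ≤ a) (hρ : (a + 1) * ρ ≤ 1 / 2)
    {x : UnitAddCircle} (hx : ∀ n, ‖metallicDenom a n • x‖ ≤ ρ) : x = 0 := by
  obtain ⟨r, rfl, hr⟩ := UnitAddCircle.exists_coe_eq_abs_le_half x
  -- Up to `1 / 2` the circle norm is the absolute value of the real lift, so the bound `ρ` passes
  -- to the lift.
  have hsmall : ∀ n, |metallicDenom a n * r| ≤ 1 / 2 → |metallicDenom a n * r| ≤ ρ := by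
    intro n hn
    have h := (AddCircle.norm_coe_eq_abs_iff (p := 1) one_ne_zero
      (x := metallicDenom a n * r)).2 (by simpa using hn)
    rw [← h, ← nsmul_eq_mul, AddCircle.coe_nsmul]
    exact hx n
  have hρ0 : 0 ≤ ρ := (norm_nonneg _).trans (hx 0)
  have ha' : (2 : ℝ) ≤ a := by exact_mod_cast ha
  have hstep : ∀ n, |metallicDenom a n * r| ≤ ρ := by
    intro n
    induction n using Nat.twoStepInduction with
    | zero => exact hsmall 0 (by simpa [metallicDenom] using hr)
    | one =>
      refine hsmall 1 ?_
      have := hsmall 0 (by simpa [metallicDenom] using hr)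
      simp only [metallicDenom, Nat.cast_one, one_mul] at this
      rw [metallicDenom, abs_mul, Nat.abs_cast]
      nlinarith
    | more n h0 h1 =>
      refine hsmall _ ?_
      rw [metallicDenom]
      push_cast
      rw [add_mul, mul_assoc]
      refine (abs_add_le _ _).trans ?_
      rw [abs_mul (a : ℝ), Nat.abs_cast]
      nlinarith
  suffices r = 0 by simp [this]
  by_contra hr0
  -- The denominators are unbounded, so a nonzero lift would violate `hstep`.
  obtain ⟨n, hn⟩ := exists_nat_gt (ρ / |r|)
  rw [div_lt_iff₀ (abs_pos.2 hr0)] at hn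
  have h := hstep n
  rw [abs_mul, Nat.abs_cast] at h
  have hq : (n : ℝ) + 1 ≤ metallicDenom a n := by exact_mod_cast succ_le_metallicDenom ha n
  nlinarith [abs_pos.2 hr0]

end MetallicMean

/-! ### Fourier analysis of Birkhoff sums over a rotation -/

section CircleFourier

/-- The chord has length `2 |sin (π r)|`, and Jordan's inequality bounds the sine from below. -/
theorem four_mul_norm_le_norm_fourier_one_sub_one (x : UnitAddCircle) :
    4 * ‖x‖ ≤ ‖(fourier 1 x : ℂ) - 1‖ := by
  obtain ⟨r, rfl, hr⟩ := UnitAddCircle.exists_coe_eq_abs_le_half x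
  rw [(AddCircle.norm_coe_eq_abs_iff (p := 1) one_ne_zero).2 (by simpa using hr),
    fourier_coe_apply]
  have : (2 * Real.pi * Complex.I * (1 : ℤ) * r / (1 : ℝ) : ℂ) =
      Complex.I * ((2 * Real.pi * r : ℝ) : ℂ) := by push_cast; ring
  rw [this, Complex.norm_exp_I_mul_ofReal_sub_one, Real.norm_eq_abs, abs_mul, abs_two,
    show 2 * Real.pi * r / 2 = Real.pi * r by ring]
  have h := Real.mul_abs_le_abs_sin (x := Real.pi * r) (by
    rw [abs_mul, abs_of_pos Real.pi_pos]; nlinarith [Real.pi_pos])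
  rw [abs_mul, abs_of_pos Real.pi_pos, ← mul_assoc, div_mul_cancel₀ _ Real.pi_ne_zero] at h
  linarith

theorem norm_fourier_one_sub_one_le (x : UnitAddCircle) :
    ‖(fourier 1 x : ℂ) - 1‖ ≤ 2 * Real.pi * ‖x‖ := by
  obtain ⟨r, rfl, hr⟩ := UnitAddCircle.exists_coe_eq_abs_le_half x
  rw [(AddCircle.norm_coe_eq_abs_iff (p := 1) one_ne_zero).2 (by simpa using hr),
    fourier_coe_apply]
  have : (2 * Real.pi * Complex.I * (1 : ℤ) * r / (1 : ℝ) : ℂ) =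
      Complex.I * ((2 * Real.pi * r : ℝ) : ℂ) := by push_cast; ring
  rw [this]
  refine (Real.norm_exp_I_mul_ofReal_sub_one_le).trans ?_
  rw [Real.norm_eq_abs, abs_mul, abs_of_pos Real.two_pi_pos]

theorem fourier_natCast_eq_fourier_one_nsmul (n : ℕ) (x : UnitAddCircle) :
    (fourier (n : ℤ) x : ℂ) = fourier 1 (n • x) := by
  simp [fourier_apply]

theorem fourier_apply_nsmul (k : ℤ) (n : ℕ) (x : UnitAddCircle) :
    (fourier k (n • x) : ℂ) = fourier k x ^ n := by
  rw [fourier_apply, fourier_apply, smul_comm, AddCircle.toCircle_nsmul, Circle.coe_pow]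

theorem fourier_apply_add (k : ℤ) (x y : UnitAddCircle) :
    (fourier k (x + y) : ℂ) = fourier k x * fourier k y := by
  simp [fourier_apply, smul_add, AddCircle.toCircle_add]

theorem fourierCoeff_comp_add_right (g : UnitAddCircle → ℂ) (b : UnitAddCircle) (k : ℤ) :
    fourierCoeff (fun z => g (z + b)) k = fourier k b * fourierCoeff g k := by
  have h := MeasureTheory.integral_add_right_eq_self (μ := AddCircle.haarAddCircle)
    (fun z => fourier (-k) (z - b) • g z) b
  simp only [add_sub_cancel_right] at h
  rw [fourierCoeff, h, fourierCoeff, ← MeasureTheory.integral_const_mul]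
  congr 1
  ext z
  rw [sub_eq_add_neg, fourier_apply_add, smul_eq_mul, smul_eq_mul,
    show (fourier (-k) (-b) : ℂ) = fourier k b by simp [fourier_apply]]
  ring

theorem norm_fourierCoeff_le {g : UnitAddCircle → ℂ} {C : ℝ} (hg : ∀ x, ‖g x‖ ≤ C) (k : ℤ) :
    ‖fourierCoeff g k‖ ≤ C := by
  have := MeasureTheory.norm_integral_le_of_norm_le_const (μ := AddCircle.haarAddCircle)
    (f := fun t : UnitAddCircle => fourier (-k) t • g t) (C := C) (MeasureTheory.ae_of_all _ fun t => by
      rw [norm_smul, fourier_apply, Circle.norm_coe, one_mul]; exact hg t)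
  simpa only [fourierCoeff, MeasureTheory.probReal_univ, mul_one] using this

theorem integrable_haarAddCircle_of_continuous {g : UnitAddCircle → ℂ} (hg : Continuous g) :
    MeasureTheory.Integrable g AddCircle.haarAddCircle :=
  hg.integrable_of_hasCompactSupport (HasCompactSupport.of_compactSpace g)

/-- The powers of a nontrivial complex number do not all stay close to `1`. -/
theorem exists_half_le_norm_pow_sub_one {w : ℂ} (hw : w ≠ 1) : ∃ n : ℕ, 1 / 2 ≤ ‖w ^ n - 1‖ := by
  by_contra! H
  -- While the powers stay within `1 / 2` of `1`, each squaring multiplies the distance to `1` by at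
  -- least `3 / 2`.
  have hgrow : ∀ j : ℕ, (3 / 2 : ℝ) ^ j * ‖w - 1‖ ≤ ‖w ^ 2 ^ j - 1‖ := by
    intro j
    induction j with
    | zero => simp
    | succ j ih =>
      have hfac : w ^ 2 ^ (j + 1) - 1 = (w ^ 2 ^ j - 1) * (2 + (w ^ 2 ^ j - 1)) := by ring
      have h2 : 3 / 2 ≤ ‖2 + (w ^ 2 ^ j - 1)‖ := by
        have h := norm_sub_le_norm_add (2 : ℂ) (w ^ 2 ^ j - 1)
        rw [Complex.norm_two] at h
        linarith [H (2 ^ j)]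
      rw [hfac, norm_mul, pow_succ]
      nlinarith [norm_nonneg (w ^ 2 ^ j - 1)]
  have hpos : 0 < ‖w - 1‖ := norm_pos_iff.2 (sub_ne_zero.2 hw)
  obtain ⟨j, hj⟩ := pow_unbounded_of_one_lt (1 / ‖w - 1‖) (show (1 : ℝ) < 3 / 2 by norm_num)
  rw [div_lt_iff₀ hpos] at hj
  linarith [hgrow j, H (2 ^ j)]

theorem iterate_circleRotation (α : ℝ) (n : ℕ) (x : UnitAddCircle) :
    (circleRotation α)^[n] x = x + n • (α : UnitAddCircle) := by
  change (fun z : UnitAddCircle => z + (α : UnitAddCircle))^[n] x = _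
  rw [add_right_iterate]

theorem denseRange_iterate_circleRotation {α : ℝ} (hα : Irrational α) (x : UnitAddCircle) :
    DenseRange fun n : ℕ => (circleRotation α)^[n] x := by
  have h : DenseRange fun n : ℕ => n • (α : UnitAddCircle) :=
    denseRange_zsmul_iff_nsmul.1 (AddCircle.denseRange_zsmul_coe_iff.2 (by simpa using hα))
  simp only [iterate_circleRotation]
  exact (Homeomorph.addLeft x).surjective.denseRange.comp h (Homeomorph.addLeft x).continuous

variable {α c : ℝ} {T : C(UnitAddCircle, ℝ)} {x h : UnitAddCircle}

theorem continuous_birkhoffSum_circleRotation (α : ℝ) (T : C(UnitAddCircle, ℝ)) (n : ℕ) :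
    Continuous (birkhoffSum (circleRotation α) T n) := by
  unfold birkhoffSum
  exact continuous_finsetSum _ fun k _ =>
    T.continuous.comp ((circleRotation α).continuous.iterate k)

/-- A bound for the differences of the Birkhoff sums along one orbit propagates to the circle. -/
theorem abs_birkhoffSum_sub_le_of_orbit (hα : Irrational α)
    (H : ∀ n : ℕ, |birkhoffSum (circleRotation α) T n x -
      birkhoffSum (circleRotation α) T n (x + h)| < c) (n : ℕ) (z : UnitAddCircle) :
    |birkhoffSum (circleRotation α) T n z - birkhoffSum (circleRotation α) T n (z + h)| ≤
      2 * c := by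
  have hcont := continuous_birkhoffSum_circleRotation α T n
  refine (denseRange_iterate_circleRotation hα x).induction_on z
    (isClosed_le (by fun_prop) continuous_const) fun m => ?_
  have hh : (circleRotation α)^[m] x + h = (circleRotation α)^[m] (x + h) := by
    rw [iterate_circleRotation, iterate_circleRotation, add_right_comm]
  rw [hh]
  -- The sum started at the `m`-th orbit point is the difference of the sums of lengths `m + n` and
  -- `m`; each contributes one `c`.
  have e1 := birkhoffSum_add (circleRotation α) T m n x
  have e2 := birkhoffSum_add (circleRotation α) T m n (x + h)
  have b1 := abs_lt.1 (H m)
  have b2 := abs_lt.1 (H (m + n))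
  rw [abs_le]
  constructor <;> linarith [b1.1, b1.2, b2.1, b2.2]

/-- Translating by `i • α` multiplies the coefficient by the `i`-th power of `fourier k α`, leaving
a geometric sum. -/
theorem fourierCoeff_birkhoffSum_mul (α : ℝ) (T : C(UnitAddCircle, ℝ)) (n : ℕ) (k : ℤ) :
    fourierCoeff (fun z => ((birkhoffSum (circleRotation α) T n z : ℝ) : ℂ)) k *
        (fourier k (α : UnitAddCircle) - 1) =
      (fourier k (α : UnitAddCircle) ^ n - 1) * fourierCoeff (fun z => (T z : ℂ)) k := by
  have hsum : (fun z => ((birkhoffSum (circleRotation α) T n z : ℝ) : ℂ)) =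
      ∑ i ∈ Finset.range n, fun z => (T (z + i • (α : UnitAddCircle)) : ℂ) := by
    ext z
    simp [birkhoffSum, iterate_circleRotation]
  rw [hsum, fourierCoeff.sum _ _ fun i _ => integrable_haarAddCircle_of_continuous (by fun_prop),
    Finset.sum_apply]
  simp only [fourierCoeff_comp_add_right (fun z => (T z : ℂ)), fourier_apply_nsmul]
  rw [← Finset.sum_mul, mul_right_comm, geom_sum_mul]

/-- If the Birkhoff sums of `T` along the orbits of `x` and `x + h` stay close, then `h` is almost
resonant with each Fourier mode of `T`. -/
theorem norm_fourierCoeff_mul_le_of_orbit (hα : Irrational α)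
    (H : ∀ n : ℕ, |birkhoffSum (circleRotation α) T n x -
      birkhoffSum (circleRotation α) T n (x + h)| < c) {k : ℤ}
    (hk : (fourier k (α : UnitAddCircle) : ℂ) ≠ 1) :
    ‖fourierCoeff (fun z => (T z : ℂ)) k‖ * ‖(fourier k h : ℂ) - 1‖ ≤
      4 * c * ‖(fourier k (α : UnitAddCircle) : ℂ) - 1‖ := by
  obtain ⟨n, hn⟩ := exists_half_le_norm_pow_sub_one hk
  have hcont := continuous_birkhoffSum_circleRotation α T n
  set S : UnitAddCircle → ℂ := fun z => ((birkhoffSum (circleRotation α) T n z : ℝ) : ℂ) with hS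
  have hScont : Continuous S := Complex.continuous_ofReal.comp hcont
  have hD : fourierCoeff ((fun z => S (z + h)) + (-1 : ℂ) • S) k =
      (fourier k h - 1) * fourierCoeff S k := by
    rw [fourierCoeff.add (integrable_haarAddCircle_of_continuous (by fun_prop))
      (integrable_haarAddCircle_of_continuous (by fun_prop)), Pi.add_apply,
      fourierCoeff.const_smul, fourierCoeff_comp_add_right]
    simp only [smul_eq_mul]
    ring
  have hbound : ‖fourierCoeff ((fun z => S (z + h)) + (-1 : ℂ) • S) k‖ ≤ 2 * c := by
    refine norm_fourierCoeff_le (fun z => ?_) k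
    have := abs_birkhoffSum_sub_le_of_orbit hα H n z
    rw [abs_sub_comm] at this
    simp only [hS, Pi.add_apply, Pi.smul_apply, smul_eq_mul, neg_one_mul, ← sub_eq_add_neg]
    rwa [← Complex.ofReal_sub, Complex.norm_real, Real.norm_eq_abs]
  rw [hD, norm_mul] at hbound
  have hmul := congrArg norm (fourierCoeff_birkhoffSum_mul α T n k)
  rw [norm_mul, norm_mul] at hmul
  -- The choice of `n` makes twice this factor at least `1`.
  calc _ ≤ 2 * (‖(fourier k (α : UnitAddCircle) : ℂ) ^ n - 1‖ *
          ‖fourierCoeff (fun z => (T z : ℂ)) k‖) * ‖(fourier k h : ℂ) - 1‖ := by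
        refine mul_le_mul_of_nonneg_right ?_ (norm_nonneg _)
        nlinarith [norm_nonneg (fourierCoeff (fun z => (T z : ℂ)) k)]
    _ = 2 * (‖(fourier k h : ℂ) - 1‖ * ‖fourierCoeff S k‖) *
          ‖(fourier k (α : UnitAddCircle) : ℂ) - 1‖ := by rw [← hmul]; ring
    _ ≤ 2 * (2 * c) * ‖(fourier k (α : UnitAddCircle) : ℂ) - 1‖ := by gcongr
    _ = _ := by ring

end CircleFourier

/-! ### The lacunary return time -/

section LacunaryReturnTime

variable {r : ℝ} {q : ℕ → ℕ}

theorem abs_re_fourier_le (k : ℤ) (x : UnitAddCircle) : |(fourier k x : ℂ).re| ≤ 1 :=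
  (Complex.abs_re_le_norm _).trans_eq (by rw [fourier_apply, Circle.norm_coe])

theorem norm_pow_mul_re_fourier_le (hr : 0 ≤ r) (j : ℕ) (k : ℤ) (x : UnitAddCircle) :
    ‖r ^ j * (fourier k x : ℂ).re‖ ≤ r ^ j := by
  rw [norm_mul, norm_pow, Real.norm_of_nonneg hr]
  exact mul_le_of_le_one_right (by positivity) (abs_re_fourier_le k x)

/-- The function `3 + ∑ r ^ j cos (2 π q_j x)` on the circle. -/
def lacunaryReturnTime (r : ℝ) (hr0 : 0 ≤ r) (hr1 : r < 1) (q : ℕ → ℕ) : C(UnitAddCircle, ℝ) where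
  toFun x := 3 + ∑' j : ℕ, r ^ j * (fourier (q j : ℤ) x : ℂ).re
  continuous_toFun := continuous_const.add
    (continuous_tsum (fun _ => by fun_prop) (summable_geometric_of_lt_one hr0 hr1)
      fun j x => norm_pow_mul_re_fourier_le hr0 j _ x)

/-- For `r ≤ 1 / 2` the series is at most `2` in absolute value, which the constant `3` absorbs. -/
theorem one_le_lacunaryReturnTime (hr0 : 0 ≤ r) (hr1 : r < 1) (hr : r ≤ 1 / 2)
    (x : UnitAddCircle) : 1 ≤ lacunaryReturnTime r hr0 hr1 q x := by
  have h : ‖∑' j : ℕ, r ^ j * (fourier (q j : ℤ) x : ℂ).re‖ ≤ (1 - r)⁻¹ :=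
    tsum_of_norm_bounded (hasSum_geometric_of_lt_one hr0 hr1)
      fun j => norm_pow_mul_re_fourier_le hr0 j _ x
  have h2 : (1 - r)⁻¹ ≤ 2 := by
    rw [inv_le_comm₀ (by linarith) (by norm_num)]; linarith
  change (1 : ℝ) ≤ 3 + ∑' j : ℕ, r ^ j * (fourier (q j : ℤ) x : ℂ).re
  linarith [(abs_le.1 h).1]

theorem fourierCoeff_re_fourier (n k : ℤ) :
    fourierCoeff (fun x : UnitAddCircle => ((fourier n x : ℂ).re : ℂ)) k =
      ((Pi.single n 1 : ℤ → ℂ) k + (Pi.single (-n) 1 : ℤ → ℂ) k) / 2 := by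
  have h : (fun x : UnitAddCircle => ((fourier n x : ℂ).re : ℂ)) =
      (1 / 2 : ℂ) • ((fourier n : UnitAddCircle → ℂ) + (fourier (-n) : UnitAddCircle → ℂ)) := by
    ext x
    rw [Complex.re_eq_add_conj, ← fourier_neg]
    simp only [Pi.smul_apply, Pi.add_apply, smul_eq_mul]
    ring
  rw [h, fourierCoeff.const_smul, fourierCoeff.add
    (integrable_haarAddCircle_of_continuous (by fun_prop))
    (integrable_haarAddCircle_of_continuous (by fun_prop)), fourierCoeff_fourier,
    fourierCoeff_fourier, Pi.add_apply, smul_eq_mul]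
  ring

/-- All cosine weights are nonnegative, so terms sharing the frequency `q j` cannot cancel and
injectivity of `q` is not needed. The constant `3` only affects frequency `0`. -/
theorem half_pow_le_norm_fourierCoeff_lacunaryReturnTime (hr0 : 0 ≤ r) (hr1 : r < 1) {j : ℕ}
    (hq : q j ≠ 0) :
    r ^ j / 2 ≤ ‖fourierCoeff (fun z => (lacunaryReturnTime r hr0 hr1 q z : ℂ)) (q j)‖ := by
  set F : ℕ → UnitAddCircle → ℂ := fun i z =>
    ((r ^ i : ℝ) : ℂ) • ((fourier (q i : ℤ) z : ℂ).re : ℂ)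
    with hF
  have hFcont : ∀ i, Continuous (F i) := fun i => by
    simp only [hF]
    fun_prop
  have hFle : ∀ i z, ‖F i z‖ ≤ r ^ i := fun i z => by
    have := norm_pow_mul_re_fourier_le hr0 i (q i) z
    simp only [hF]
    rwa [smul_eq_mul, ← Complex.ofReal_mul, Complex.norm_real]
  have hgeo := summable_geometric_of_lt_one hr0 hr1
  have hFsum : Continuous fun z => ∑' i, F i z := continuous_tsum hFcont hgeo hFle
  have hT : (fun z => (lacunaryReturnTime r hr0 hr1 q z : ℂ)) =
      (3 : ℂ) • (fourier 0 : UnitAddCircle → ℂ) + fun z => ∑' i, F i z := by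
    ext z
    change ((3 + ∑' i : ℕ, r ^ i * (fourier (q i : ℤ) z : ℂ).re : ℝ) : ℂ) = _
    simp only [Pi.add_apply, Pi.smul_apply, fourier_zero, hF, smul_eq_mul, mul_one]
    push_cast
    rfl
  have hcoeff : ∀ i, fourierCoeff (F i) (q j) =
      ((r ^ i * (((if q i = q j then 1 else 0) + 0) / 2) : ℝ) : ℂ) := by
    intro i
    have : F i = ((r ^ i : ℝ) : ℂ) • fun z => ((fourier (q i : ℤ) z : ℂ).re : ℂ) := rfl
    rw [this, fourierCoeff.const_smul, fourierCoeff_re_fourier, Pi.single_apply, Pi.single_apply,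
      if_neg (show ¬ (q j : ℤ) = -(q i : ℤ) by omega)]
    have hiff : ((q j : ℤ) = q i) ↔ q i = q j := by omega
    simp only [hiff, smul_eq_mul]
    split_ifs <;> push_cast <;> rfl
  have hsum : HasSum (fun i => fourierCoeff (F i) (q j))
      (fourierCoeff (fun z => ∑' i, F i z) (q j)) := by
    have hint : ∀ i, MeasureTheory.Integrable
        (fun z => (fourier (-(q j : ℤ)) z : ℂ) • F i z) AddCircle.haarAddCircle := fun i =>
      (integrable_haarAddCircle_of_continuous (hFcont i)).fourier_smul _
    have := MeasureTheory.hasSum_integral_of_summable_integral_norm hint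
      (hgeo.of_nonneg_of_le (fun i => MeasureTheory.integral_nonneg fun z => norm_nonneg _)
        fun i => by
          have hn := MeasureTheory.norm_integral_le_of_norm_le_const
            (μ := AddCircle.haarAddCircle) (C := r ^ i)
            (f := fun z : UnitAddCircle => ‖(fourier (-(q j : ℤ)) z : ℂ) • F i z‖)
            (MeasureTheory.ae_of_all _ fun z => by
              rw [norm_norm, norm_smul, fourier_apply, Circle.norm_coe, one_mul]
              exact hFle i z)
          simpa using (le_abs_self _).trans hn)
    have he : fourierCoeff (fun z => ∑' i, F i z) (q j) =
        ∫ z, ∑' i, (fourier (-(q j : ℤ)) z : ℂ) • F i z ∂AddCircle.haarAddCircle :=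
      MeasureTheory.integral_congr_ae (MeasureTheory.ae_of_all _ fun z => tsum_mul_left.symm)
    rw [he]
    exact this
  rw [hT, fourierCoeff.add (integrable_haarAddCircle_of_continuous (by fun_prop))
    (integrable_haarAddCircle_of_continuous hFsum), Pi.add_apply, fourierCoeff.const_smul,
    fourierCoeff_fourier, Pi.single_apply, if_neg (by exact_mod_cast hq), smul_zero, zero_add]
  simp only [hcoeff] at hsum
  have hre := Complex.hasSum_re hsum
  simp only [Complex.ofReal_re] at hre
  refine le_trans ?_ ((le_hasSum hre j fun i _ => ?_).trans (Complex.re_le_norm _))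
  · simp [div_eq_mul_inv]
  · have : (0 : ℝ) ≤ if q i = q j then 1 else 0 := by split_ifs <;> norm_num
    positivity

end LacunaryReturnTime

/-! ### Separation of orbits and the theorem -/

theorem eq_of_abs_birkhoffSum_lacunaryReturnTime_lt {a : ℕ} {α : ℝ} (ha : 2 ≤ a) (hα : 0 < α)
    (h : α ^ 2 + a * α = 1) (hα1 : α < 1) {x y : UnitAddCircle}
    (H : ∀ n : ℕ, |birkhoffSum (circleRotation α)
        (lacunaryReturnTime α hα.le hα1 (metallicDenom a)) n x -
      birkhoffSum (circleRotation α)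
        (lacunaryReturnTime α hα.le hα1 (metallicDenom a)) n y| < 1 / 100) : x = y := by
  have hirr := irrational_of_sq_add_mul_eq_one (by omega) hα h
  have haα := mul_lt_one_of_sq_add_mul_eq_one hα h
  have ha' : (2 : ℝ) ≤ a := by exact_mod_cast ha
  obtain ⟨z, rfl⟩ : ∃ z, y = x + z := ⟨y - x, by abel⟩
  suffices z = 0 by simp [this]
  -- The radius `α / 6` is admissible because `(a + 1) * α < 2`. It is reached because the Fourier
  -- estimate with `c = 1 / 100` gives the bound `4 * c * π * α`, and `π < 4`.
  refine eq_zero_of_norm_metallicDenom_nsmul_le (a := a) (ρ := α / 6) ha (by nlinarith) fun n => ?_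
  have hq : metallicDenom a n ≠ 0 := by have := succ_le_metallicDenom ha n; omega
  have hne : (fourier (metallicDenom a n : ℤ) (α : UnitAddCircle) : ℂ) ≠ 1 := by
    intro heq
    rw [fourier_natCast_eq_fourier_one_nsmul] at heq
    have h4 := four_mul_norm_le_norm_fourier_one_sub_one (metallicDenom a n • (α : UnitAddCircle))
    rw [heq, sub_self, norm_zero] at h4
    have h0 : metallicDenom a n • (α : UnitAddCircle) = 0 :=
      norm_le_zero_iff.1 (by linarith)
    rw [← AddCircle.coe_nsmul, AddCircle.coe_eq_zero_iff] at h0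
    obtain ⟨m, hm⟩ := h0
    refine (hirr.natCast_mul hq).ne_int m ?_
    simpa using hm.symm
  have hmain := norm_fourierCoeff_mul_le_of_orbit hirr H hne
  have hlow := half_pow_le_norm_fourierCoeff_lacunaryReturnTime (q := metallicDenom a)
    hα.le hα1 hq
  rw [fourier_natCast_eq_fourier_one_nsmul, fourier_natCast_eq_fourier_one_nsmul] at hmain
  have h1 := four_mul_norm_le_norm_fourier_one_sub_one (metallicDenom a n • z)
  have h2 := norm_fourier_one_sub_one_le (metallicDenom a n • (α : UnitAddCircle))
  have h3 := norm_metallicDenom_nsmul_le hα h n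
  have hpow : 0 < α ^ n := by positivity
  have hchain : α ^ n / 2 * (4 * ‖metallicDenom a n • z‖) ≤
      4 * (1 / 100) * (2 * Real.pi * α ^ (n + 1)) :=
    calc _ ≤ _ := mul_le_mul hlow h1 (by positivity) (norm_nonneg _)
      _ ≤ _ := hmain
      _ ≤ 4 * (1 / 100) * (2 * Real.pi * ‖metallicDenom a n • (α : UnitAddCircle)‖) := by gcongr
      _ ≤ _ := by gcongr
  rw [pow_succ] at hchain
  have hdiv : 2 * ‖metallicDenom a n • z‖ ≤ 8 / 100 * Real.pi * α :=
    le_of_mul_le_mul_left (by linarith) hpow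
  nlinarith [Real.pi_lt_four]

end

theorem theorem2 (a : ℕ) (ha : 10 ^ 10 ≤ a) :
    ∃ α : ℝ, Irrational α ∧
      -- the continued fraction expansion of `α` is `[0; a, a, a, …]`
      (GenContFract.of α).h = 0 ∧
      (∀ n : ℕ, (GenContFract.of α).s.get? n = some ⟨1, (a : ℝ)⟩) ∧
      ∃ T : C(UnitAddCircle, ℝ), (∀ x, 0 < T x) ∧
        CompactSpace (SuspensionSpace (circleRotation α) T) ∧
        TopologicalSpace.MetrizableSpace (SuspensionSpace (circleRotation α) T) ∧
        IsKinematicExpansive (suspensionFlow (circleRotation α) T) ∧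
        IsForwardKinematicExpansive (suspensionFlow (circleRotation α) T) := by
  obtain ⟨α, hα, h⟩ := exists_pos_sq_add_mul_eq_one a
  have ha1 : 1 ≤ a := by omega
  have hα1 := lt_one_of_sq_add_mul_eq_one ha1 hα h
  have hhalf : α ≤ 1 / 2 := by
    have : (2 : ℝ) ≤ a := by exact_mod_cast (show 2 ≤ a by omega)
    nlinarith
  have hT := one_le_lacunaryReturnTime (q := metallicDenom a) hα.le hα1 hhalf
  have hpos : ∀ x, 0 < lacunaryReturnTime α hα.le hα1 (metallicDenom a) x :=
    fun x => one_pos.trans_le (hT x)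
  have hexp : IsForwardKinematicExpansive (suspensionFlow (circleRotation α)
      (lacunaryReturnTime α hα.le hα1 (metallicDenom a))) :=
    isForwardKinematicExpansive_of_birkhoffSum one_pos hT (by norm_num : (0 : ℝ) < 1 / 100)
      fun x y _ H => eq_of_abs_birkhoffSum_lacunaryReturnTime_lt (by omega) hα h hα1 H
  refine ⟨α, irrational_of_sq_add_mul_eq_one ha1 hα h, ?_,
    genContFract_get?_of_sq_add_mul_eq_one ha1 hα h,
    lacunaryReturnTime α hα.le hα1 (metallicDenom a), hpos, SuspensionSpace.compactSpace hpos,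
    SuspensionSpace.metrizableSpace one_pos hT, hexp.isKinematicExpansive, hexp⟩
  rw [GenContFract.of_h_eq_floor, floor_eq_zero_of_sq_add_mul_eq_one ha1 hα h, Int.cast_zero]
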